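/- **Model.** A state is a triple $(i,j,k)$ of nonnegative integers with $i+j\le C$ and $k\le W$ ($i$ voice users in LTE, $j$ data users in LTE, $k$ data users in WiFi). Events and their rates are: $E_1$ voice arrival ($\lambda_v$), $E_2$ data arrival ($\lambda_d$), $E_3$ voice departure ($i\mu_v$), $E_4$ data departure from LTE ($j\mu_d$), $E_5$ data departure from WiFi ($k\mu_d$), with $\lambda_v,\lambda_d,\mu_v,\mu_d>0$. The feasible actions and resulting states are: - $E_1$: $A_1$ block, state unchanged (feasible if $(i,j,k)\neq(0,0,0)$); $A_2\to(i+1,j,k)$ (if $i+j<C$); $A_4\to(i+1,j-1,k+1)$ (if $j>0$, $k<W$). - $E_2$: $A_1$ block (only if $i+j=C$ and $k=W$); $A_2\to(i,j+1,k)$ (if $i+j<C$); $A_3\to(i,j,k+1)$ (if $k<W$). - $E_3$: $A_1\to(i-1,j,k)$; $A_5\to(i-1,j+1,k-1)$ (if $k>0$). - $E_4$: $A_1\to(i,j-1,k)$; $A_5\to(i,j,k-1)$ (if $k>0$). - $E_5$: $A_1\to(i,j,k-1)$; $A_5\to(i,j-1,k)$ (if $j>0$). A memoryless policy $M$ chooses,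 possibly at random, a feasible action as a function of the state and the event; it makes the system a finite continuous-time Markov chain. The reward rate in state $(i,j,k)$ is $f(i,j,k)=iR_{L,V}+jR_{L,D}+kR_{W,D}(k)$; the cost rate is $1$ from the blocking of a voice user until the next event and $0$ otherwise. Let $V^M$ and $B^M$ be the long-run averages $\lim_{t\to\infty}\frac1t\mathbb E_M[R(t)]$ and $\lim_{t\to\infty}\frac1t\mathbb E_M[C(t)]$ of the accumulated reward and cost. The unconstrained problem is to maximize $V^M$ over memoryless policies; the constrained problem is to maximize $V^M$ subject to $B^M\le B_{\max}$. For $\delta>0$ with $\delta\,v(s)\le1$ in all states $s$ ($v(s)$ the total event rate) and $\beta\in\mathbb R$, the uniformized dynamic program has the operator $$(TV)(s)=\sum_{l}\hat p(s,E_l)\max_a\big[f(s'(E_l,a))-\beta\,\mathbf 1\{E_l=E_1,a=A_1\}+V(s'(E_l,a))\big]+\Big(1-\sum_l\hat p(s,E_l)\Big)V(s),$$ where $\hat p(s,E_l)$ is $\delta$ times the rate of $E_l$ in $s$, the maximum is over feasible actions and $s'(E_l,a)$ is the resulting state. **Assumption.** Put $\tilde R_{W,D}(k)=(k+1)R_{W,D}(k+1)-kR_{W,D}(k)$.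 There is a threshold $k_{th}\le W$ with $R_{L,D}\ge\tilde R_{W,D}(k)$ for all $k\ge k_{th}$ and $R_{L,D}<\tilde R_{W,D}(k)$ for all $k<k_{th}$. **Lemma 1.** Under this assumption, in states with $i+j<C$ and $j+k\le k_{th}$ the optimal policy serves all data users on WiFi: 1. Let $M$ be any optimal policy of the unconstrained problem, or of the constrained problem for some $B_{\max}$. Every recurrent state $(i,j,k)$ of $M$ with $i+j<C$ and $j+k\le k_{th}$ has $j=0$; in such a state $M$ accepts an arriving data user on WiFi ($A_3$) if $j+k<k_{th}$, and does nothing ($A_1$) at a departure, with probability one. 2. Let $V$ be any value-iteration iterate $T^n0$, $n\ge0$, or any solution of $g+V=TV$, $g\in\mathbb R$. In every state with $i+j<C$ and $j+k\le k_{th}$ the maximizing action is unique and is: $A_3$ at a data arrival if $j+k<k_{th}$; $A_1$ at a voice departure and at a data departure from LTE; at a data departure from WiFi, $A_1$ if $j=0$, and $A_5$ (move an LTE data user to WiFi) if $j>0$. -/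

import Mathlib

open Filter Topology

namespace HetNet

/-- The data of the LTE/WiFi model: LTE capacity `C`, WiFi capacity `W`, arrival rates
`lamV, lamD` and service rates `muV, muD` of voice and data users, bit rates `RLV, RLD` of a voice
and of a data user in LTE, and per-user throughput `RWD k` in WiFi when it serves `k` users. -/
structure Params where
  C : ℕ
  W : ℕ
  lamV : ℝ
  lamD : ℝ
  muV : ℝ
  muD : ℝ
  RLV : ℝ
  RLD : ℝ
  RWD : ℕ → ℝ

/-- A triple `(i, j, k)`: voice users in LTE, data users in LTE, data users in WiFi. -/
@[ext]
structure Triple where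
  i : ℕ
  j : ℕ
  k : ℕ
  deriving DecidableEq

/-- The events: `E1` voice arrival, `E2` data arrival, `E3` voice departure (from LTE),
`E4` data departure from LTE, `E5` data departure from WiFi. -/
inductive Event
  | E1 | E2 | E3 | E4 | E5
  deriving DecidableEq

instance : Fintype Event :=
  ⟨{Event.E1, Event.E2, Event.E3, Event.E4, Event.E5}, by intro e; cases e <;> decide⟩

/-- The actions: `A1` block the arriving user / do nothing at a departure, `A2` accept in LTE,
`A3` accept the data user in WiFi, `A4` accept the voice user in LTE and offload one data user
from LTE to WiFi, `A5` move one data user to the network from which the departure occurred. -/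
inductive Act
  | A1 | A2 | A3 | A4 | A5
  deriving DecidableEq

instance : Fintype Act :=
  ⟨{Act.A1, Act.A2, Act.A3, Act.A4, Act.A5}, by intro a; cases a <;> decide⟩

open Event Act

/-- The state space `{(i,j,k) : i + j ≤ C, k ≤ W}`. -/
def Params.states (p : Params) : Finset Triple :=
  (((Finset.range (p.C + 1) ×ˢ Finset.range (p.C + 1) ×ˢ Finset.range (p.W + 1)).image
    (fun x => (⟨x.1, x.2.1, x.2.2⟩ : Triple))).filter (fun s => s.i + s.j ≤ p.C))

theorem Params.mem_states (p : Params) (s : Triple) :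
    s ∈ p.states ↔ s.i + s.j ≤ p.C ∧ s.k ≤ p.W := by
  constructor
  · intro h
    simp only [Params.states, Finset.mem_filter, Finset.mem_image, Finset.mem_product,
      Finset.mem_range] at h
    obtain ⟨⟨x, hx, rfl⟩, h2⟩ := h
    exact ⟨h2, by have := hx.2.2; simp only; omega⟩
  · rintro ⟨h1, h2⟩
    simp only [Params.states, Finset.mem_filter, Finset.mem_image, Finset.mem_product,
      Finset.mem_range]
    exact ⟨⟨(s.i, s.j, s.k), ⟨by simp only; omega, by simp only; omega, by simp only; omega⟩,
      rfl⟩, h1⟩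

abbrev Params.State (p : Params) : Type := {s : Triple // s ∈ p.states}

/-- Rate at which event `e` occurs in state `s`. -/
def Params.rate (p : Params) (s : Triple) : Event → ℝ
  | E1 => p.lamV
  | E2 => p.lamD
  | E3 => s.i * p.muV
  | E4 => s.j * p.muD
  | E5 => s.k * p.muD

/-- Total event rate `v(i,j,k)`. -/
def Params.totalRate (p : Params) (s : Triple) : ℝ := ∑ e : Event, p.rate s e

/-- Whether event `e` can occur in state `s`. -/
def Possible (s : Triple) : Event → Prop
  | E1 => True
  | E2 => True
  | E3 => 0 < s.i
  | E4 => 0 < s.j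
  | E5 => 0 < s.k

/-- Feasibility of action `a` in state `s` upon event `e`. -/
def Params.Feasible (p : Params) (s : Triple) : Event → Act → Prop
  | E1, A1 => s ≠ ⟨0, 0, 0⟩
  | E1, A2 => s.i + s.j ≠ p.C
  | E1, A4 => s.j ≠ 0 ∧ s.k ≠ p.W
  | E2, A1 => s.i + s.j = p.C ∧ s.k = p.W
  | E2, A2 => s.i + s.j ≠ p.C
  | E2, A3 => s.k ≠ p.W
  | E3, A1 => s.i ≠ 0
  | E3, A5 => s.i ≠ 0 ∧ s.k ≠ 0
  | E4, A1 => s.j ≠ 0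
  | E4, A5 => s.j ≠ 0 ∧ s.k ≠ 0
  | E5, A1 => s.k ≠ 0
  | E5, A5 => s.j ≠ 0 ∧ s.k ≠ 0
  | _, _ => False

/-- The state reached from `s` under event `e` and action `a` (only used for feasible `a`, where
no subtraction is truncated; see `next_mem`). -/
def next (s : Triple) : Event → Act → Triple
  | E1, A2 => ⟨s.i + 1, s.j, s.k⟩
  | E1, A4 => ⟨s.i + 1, s.j - 1, s.k + 1⟩
  | E2, A2 => ⟨s.i, s.j + 1, s.k⟩
  | E2, A3 => ⟨s.i, s.j, s.k + 1⟩
  | E3, A1 => ⟨s.i - 1, s.j, s.k⟩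
  | E3, A5 => ⟨s.i - 1, s.j + 1, s.k - 1⟩
  | E4, A1 => ⟨s.i, s.j - 1, s.k⟩
  | E4, A5 => ⟨s.i, s.j, s.k - 1⟩
  | E5, A1 => ⟨s.i, s.j, s.k - 1⟩
  | E5, A5 => ⟨s.i, s.j - 1, s.k⟩
  | _, _ => s

/-- Feasible actions keep the system inside the state space. -/
theorem next_mem (p : Params) (s : Triple) (hs : s ∈ p.states) (e : Event) (a : Act)
    (h : p.Feasible s e a) : next s e a ∈ p.states := by
  rw [Params.mem_states] at hs ⊢
  cases e <;> cases a <;> simp only [Params.Feasible, next] at h ⊢ <;> omega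

/-- Total throughput `f(i,j,k) = i R_{L,V} + j R_{L,D} + k R_{W,D}(k)`. -/
def Params.f (p : Params) (s : Triple) : ℝ := s.i * p.RLV + s.j * p.RLD + s.k * p.RWD s.k

/-- Reward per unit time: the total throughput after event `e` and action `a`. -/
def Params.reward (p : Params) (s : Triple) (e : Event) (a : Act) : ℝ := p.f (next s e a)

/-- Cost per unit time: one if an arriving voice user is blocked. -/
def cost (e : Event) (a : Act) : ℝ := if e = E1 ∧ a = A1 then 1 else 0

/-- Throughput increment `(k+1) R_{W,D}(k+1) - k R_{W,D}(k)` in WiFi. -/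
def Params.incWD (p : Params) (k : ℕ) : ℝ := ((k : ℝ) + 1) * p.RWD (k + 1) - k * p.RWD k

/-- `kth` is a threshold of the WiFi throughput increment relative to the LTE bit rate. -/
def Params.IsThreshold (p : Params) (kth : ℕ) : Prop :=
  (∀ k, kth ≤ k → p.incWD k ≤ p.RLD) ∧ (∀ k, k < kth → p.RLD < p.incWD k)

/-! ### The continuous-time decision problem -/

/-- A memoryless (possibly randomized) policy: `prob s e a` is the probability of taking action
`a` when event `e` occurs in state `s`. -/
structure Policy (p : Params) where
  prob : p.State → Event → Act → ℝ
  nonneg : ∀ s e a, 0 ≤ prob s e a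
  feasible : ∀ s e a, prob s e a ≠ 0 → p.Feasible s.1 e a
  sum_one : ∀ s e, Possible s.1 e → ∑ a : Act, prob s e a = 1

/-- The controlled process is a continuous-time Markov chain on pairs `(s, b)`, where `s` is the
system state and `b` records whether the last event was a blocked voice arrival (on the interval
from that event to the next one the cost rate is one). This is its generator under `M`. -/
noncomputable def Policy.gen {p : Params} (M : Policy p) :
    Matrix (p.State × Bool) (p.State × Bool) ℝ :=
  fun y z => ∑ e : Event, ∑ a : Act, p.rate y.1.1 e * M.prob y.1 e a *
    ((if z.1.1 = next y.1.1 e a ∧ z.2 = decide (e = E1 ∧ a = A1) then 1 else 0)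
      - (if z = y then 1 else 0))

/-- Transition probabilities `P(Y(t) = z | Y(0) = y)` under `M`. -/
noncomputable def Policy.trans {p : Params} (M : Policy p) (t : ℝ) :
    Matrix (p.State × Bool) (p.State × Bool) ℝ :=
  NormedSpace.exp (t • M.gen)

/-- Expected total reward `E_M[R(t)]` up to time `t` from the initial state `s`: the expectation
of the time integral of the current throughput. -/
noncomputable def Policy.expReward {p : Params} (M : Policy p) (s : p.State) (t : ℝ) : ℝ :=
  ∫ u in (0 : ℝ)..t, ∑ z : p.State × Bool, M.trans u (s, false) z * p.f z.1.1

/-- Expected total cost `E_M[C(t)]` up to time `t` from the initial state `s`. -/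
noncomputable def Policy.expCost {p : Params} (M : Policy p) (s : p.State) (t : ℝ) : ℝ :=
  ∫ u in (0 : ℝ)..t, ∑ z : p.State × Bool, M.trans u (s, false) z * (if z.2 then 1 else 0)

/-- `v` is the long-run average reward `V^M = lim E_M[R(t)] / t`, from every initial state. -/
def Policy.HasAvgReward {p : Params} (M : Policy p) (v : ℝ) : Prop :=
  ∀ s : p.State, Tendsto (fun t : ℝ => (1 / t) * M.expReward s t) atTop (𝓝 v)

/-- `b` is the long-run average cost `B^M = lim E_M[C(t)] / t`, from every initial state. -/
def Policy.HasAvgCost {p : Params} (M : Policy p) (b : ℝ) : Prop :=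
  ∀ s : p.State, Tendsto (fun t : ℝ => (1 / t) * M.expCost s t) atTop (𝓝 b)

/-- `M` maximizes the average reward among all memoryless policies. -/
def Policy.IsOptimal {p : Params} (M : Policy p) : Prop :=
  ∃ v, M.HasAvgReward v ∧ ∀ (M' : Policy p) (v' : ℝ), M'.HasAvgReward v' → v' ≤ v

/-- `M` maximizes the average reward among all memoryless policies with average cost `≤ Bmax`. -/
def Policy.IsConstrainedOptimal {p : Params} (M : Policy p) (Bmax : ℝ) : Prop :=
  ∃ v b, M.HasAvgReward v ∧ M.HasAvgCost b ∧ b ≤ Bmax ∧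
    ∀ (M' : Policy p) (v' b' : ℝ),
      M'.HasAvgReward v' → M'.HasAvgCost b' → b' ≤ Bmax → v' ≤ v

/-- One-step transitions of positive rate under `M`. -/
def Policy.Step {p : Params} (M : Policy p) (s s' : p.State) : Prop :=
  ∃ e a, 0 < p.rate s.1 e ∧ 0 < M.prob s e a ∧ s'.1 = next s.1 e a

/-- `s` is a recurrent state of the (finite) chain under `M`: the chain can return to `s` from
every state that it can reach from `s`. -/
def Policy.Recurrent {p : Params} (M : Policy p) (s : p.State) : Prop :=
  ∀ s', Relation.ReflTransGen M.Step s s' → Relation.ReflTransGen M.Step s' s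

/-! ### The uniformized dynamic program with Lagrange multiplier `β` -/

/-- The quantity maximized over `a`: `r(s,e,a) - β c(s,e,a) + V(s')`. -/
noncomputable def Params.qval (p : Params) (β : ℝ) (V : Triple → ℝ) (s : Triple) (e : Event)
    (a : Act) : ℝ :=
  p.reward s e a - β * cost e a + V (next s e a)

/-- The maximum of `qval` over the feasible actions (a supremum of a finite set; it is nonempty
for every possible event when `C > 0`, and impossible events have rate zero). -/
noncomputable def Params.maxq (p : Params) (β : ℝ) (V : Triple → ℝ) (s : Triple) (e : Event) : ℝ :=
  sSup {x | ∃ a, p.Feasible s e a ∧ x = p.qval β V s e a}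

/-- Right-hand side of the dynamic programming equation; event `e` has probability
`rate s e * δ` in the uniformized chain. -/
noncomputable def Params.bellman (p : Params) (δ β : ℝ) (V : Triple → ℝ) (s : Triple) : ℝ :=
  (∑ e : Event, p.rate s e * δ * p.maxq β V s e) + (1 - ∑ e : Event, p.rate s e * δ) * V s

/-- Value iteration started at zero. -/
noncomputable def Params.valueIter (p : Params) (δ β : ℝ) : ℕ → Triple → ℝ
  | 0 => fun _ => 0
  | n + 1 => p.bellman δ β (p.valueIter δ β n)

/-- `V` solves the average-reward dynamic programming equation with gain `g` per step. -/
def Params.IsDPSolution (p : Params) (δ β g : ℝ) (V : Triple → ℝ) : Prop :=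
  ∀ s ∈ p.states, g + V s = p.bellman δ β V s

/-- Act `a` is optimal in state `s` upon event `e` with respect to the value function `V`. -/
def Params.IsMaximizer (p : Params) (β : ℝ) (V : Triple → ℝ) (s : Triple) (e : Event)
    (a : Act) : Prop :=
  p.Feasible s e a ∧ ∀ a', p.Feasible s e a' → p.qval β V s e a' ≤ p.qval β V s e a

/-- With respect to `V`, the optimal actions serve data users on WiFi in all states with
`i + j < C` and at most `kth` data users: a data user arriving when there are fewer than `kth`
data users is accepted in WiFi, a departure from LTE triggers no offload, and a departure from
WiFi triggers none if all data users are on WiFi, while otherwise an LTE data user is moved to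
WiFi. In each case the optimal action is unique. -/
def Params.ServesOnWiFi (p : Params) (kth : ℕ) (β : ℝ) (V : Triple → ℝ) : Prop :=
  ∀ s ∈ p.states, s.i + s.j < p.C → s.j + s.k ≤ kth →
    (s.j + s.k < kth → ∀ a, p.IsMaximizer β V s E2 a ↔ a = A3) ∧
    (0 < s.i → ∀ a, p.IsMaximizer β V s E3 a ↔ a = A1) ∧
    (0 < s.j → ∀ a, p.IsMaximizer β V s E4 a ↔ a = A1) ∧
    (0 < s.k → s.j = 0 → ∀ a, p.IsMaximizer β V s E5 a ↔ a = A1) ∧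
    (0 < s.k → 0 < s.j → ∀ a, p.IsMaximizer β V s E5 a ↔ a = A5)

/-- The policy `M` serves all data users on WiFi in all its recurrent states with `i + j < C` and
at most `kth` data users: such states have `j = 0`, a data user arriving when there are fewer than
`kth` data users is accepted in WiFi, and departures trigger no offload (data departures from LTE
do not occur as `j = 0`). -/
def Policy.ServesOnWiFi {p : Params} (M : Policy p) (kth : ℕ) : Prop :=
  ∀ s : p.State, M.Recurrent s → s.1.i + s.1.j < p.C → s.1.j + s.1.k ≤ kth →
    s.1.j = 0 ∧
    (s.1.j + s.1.k < kth → M.prob s E2 A3 = 1) ∧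
    (0 < s.1.i → M.prob s E3 A1 = 1) ∧
    (0 < s.1.k → M.prob s E5 A1 = 1)

end HetNet

namespace HetNet

section Chain

variable {X : Type*} [Fintype X]

/-- The generator of the finite Markov chain with transition rates `q`, acting on functions. -/
def genOp (q : X → X → ℝ) : (X → ℝ) →ₗ[ℝ] (X → ℝ) where
  toFun h x := ∑ y, q x y * (h y - h x)
  map_add' h h' := by
    funext x
    simp only [Pi.add_apply, ← Finset.sum_add_distrib]
    exact Finset.sum_congr rfl fun y _ => by ring
  map_smul' c h := by
    funext x
    simp only [Pi.smul_apply, smul_eq_mul, Finset.mul_sum, RingHom.id_apply]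
    exact Finset.sum_congr rfl fun y _ => by ring

theorem genOp_apply (q : X → X → ℝ) (h : X → ℝ) (x : X) :
    genOp q h x = ∑ y, q x y * (h y - h x) := rfl

theorem genOp_const (q : X → X → ℝ) (c : ℝ) : genOp q (fun _ => c) = 0 := by
  funext x
  simp [genOp_apply]

theorem genOp_nonpos_of_max {q : X → X → ℝ} (hq : ∀ x y, 0 ≤ q x y) {h : X → ℝ} {x : X}
    (hx : ∀ y, h y ≤ h x) : genOp q h x ≤ 0 :=
  Finset.sum_nonpos fun y _ => mul_nonpos_of_nonneg_of_nonpos (hq x y) (sub_nonpos.2 (hx y))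

theorem eq_of_max_of_rate_pos {q : X → X → ℝ} (hq : ∀ x y, 0 ≤ q x y) {h : X → ℝ} {x : X}
    (hx : ∀ y, h y ≤ h x) (h0 : 0 ≤ genOp q h x) {y : X} (hy : 0 < q x y) : h y = h x := by
  have h1 := (Finset.sum_eq_zero_iff_of_nonpos (s := Finset.univ)
    (f := fun y => q x y * (h y - h x)) fun y _ =>
      mul_nonpos_of_nonneg_of_nonpos (hq x y) (sub_nonpos.2 (hx y))).1
    (le_antisymm (genOp_nonpos_of_max hq hx) h0) y (Finset.mem_univ y)
  rcases mul_eq_zero.1 h1 with h2 | h2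
  · exact absurd h2 hy.ne'
  · linarith

/-- A maximum of a subharmonic function propagates along transitions. -/
theorem eq_of_max_of_reachable {q : X → X → ℝ} (hq : ∀ x y, 0 ≤ q x y) {h : X → ℝ}
    (h0 : ∀ x, 0 ≤ genOp q h x) {x : X} (hx : ∀ y, h y ≤ h x) {y : X}
    (hy : Relation.ReflTransGen (fun a b => 0 < q a b) x y) : h y = h x := by
  induction hy with
  | refl => rfl
  | tail _ hbc ih =>
    rw [eq_of_max_of_rate_pos hq (fun z => (hx z).trans ih.ge) (h0 _) hbc, ih]

theorem le_root_of_subharmonic {q : X → X → ℝ} (hq : ∀ x y, 0 ≤ q x y) {x₀ : X}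
    (hroot : ∀ x, Relation.ReflTransGen (fun a b => 0 < q a b) x x₀) {h : X → ℝ}
    (h0 : ∀ x, 0 ≤ genOp q h x) (x : X) : h x ≤ h x₀ := by
  have : Nonempty X := ⟨x⟩
  obtain ⟨m, hm⟩ := Finite.exists_max h
  rw [eq_of_max_of_reachable hq h0 hm (hroot m)]
  exact hm x

theorem nonpos_of_le_genOp [Nonempty X] {q : X → X → ℝ} (hq : ∀ x y, 0 ≤ q x y) {h : X → ℝ}
    {c : ℝ} (hc : ∀ x, c ≤ genOp q h x) : c ≤ 0 := by
  obtain ⟨m, hm⟩ := Finite.exists_max h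
  exact (hc m).trans (genOp_nonpos_of_max hq hm)

/-- `φ ↦ genOp q φ - φ x₀`: an injective operator when `x₀` is reachable from everywhere. -/
def rootedOp (q : X → X → ℝ) (x₀ : X) : (X → ℝ) →ₗ[ℝ] (X → ℝ) :=
  genOp q - LinearMap.pi fun _ => LinearMap.proj x₀

theorem rootedOp_apply (q : X → X → ℝ) (x₀ : X) (h : X → ℝ) (x : X) :
    rootedOp q x₀ h x = genOp q h x - h x₀ := rfl

theorem rootedOp_injective {q : X → X → ℝ} (hq : ∀ x y, 0 ≤ q x y) {x₀ : X}
    (hroot : ∀ x, Relation.ReflTransGen (fun a b => 0 < q a b) x x₀) :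
    Function.Injective (rootedOp q x₀) := by
  rw [← LinearMap.ker_eq_bot, LinearMap.ker_eq_bot']
  intro h hh
  have : Nonempty X := ⟨x₀⟩
  have e : ∀ x, genOp q h x = h x₀ := fun x => by
    have := congrFun hh x
    rw [rootedOp_apply] at this
    simpa [sub_eq_zero] using this
  have e' : ∀ x, genOp q (-h) x = -h x₀ := fun x => by rw [map_neg, Pi.neg_apply, e]
  have c1 : h x₀ ≤ 0 := nonpos_of_le_genOp hq fun x => (e x).ge
  have c2 : -h x₀ ≤ 0 := nonpos_of_le_genOp hq fun x => (e' x).ge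
  have c0 : h x₀ = 0 := by linarith
  funext x
  have l1 := le_root_of_subharmonic hq hroot (h := h) (fun x => by rw [e, c0]) x
  have l2 := le_root_of_subharmonic hq hroot (h := -h) (fun x => by rw [e', c0, neg_zero]) x
  simp only [Pi.neg_apply] at l2
  simp only [Pi.zero_apply]
  linarith

/-- A finite chain with a state reachable from everywhere has a stationary distribution, positive
on the states reachable from the root, and its Poisson equation is solvable. -/
theorem exists_stationary {q : X → X → ℝ} (hq : ∀ x y, 0 ≤ q x y) {x₀ : X}
    (hroot : ∀ x, Relation.ReflTransGen (fun a b => 0 < q a b) x x₀) :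
    ∃ π : X → ℝ, (∀ x, 0 ≤ π x) ∧ ∑ x, π x = 1 ∧
      (∀ φ : X → ℝ, ∑ x, π x * genOp q φ x = 0) ∧
      (∀ x, Relation.ReflTransGen (fun a b => 0 < q a b) x₀ x → 0 < π x) ∧
      (∀ r : X → ℝ, ∃ h : X → ℝ, ∀ x, genOp q h x = (∑ y, π y * r y) - r x) := by
  classical
  have : Nonempty X := ⟨x₀⟩
  let E := LinearEquiv.ofInjectiveEndo (rootedOp q x₀) (rootedOp_injective hq hroot)
  have hE : ∀ h, E h = rootedOp q x₀ h := fun h => rfl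
  let m : (X → ℝ) →ₗ[ℝ] ℝ :=
    LinearMap.proj x₀ ∘ₗ (E.symm : (X → ℝ) →ₗ[ℝ] (X → ℝ)) ∘ₗ (-LinearMap.id)
  have hm : ∀ r, m r = E.symm (-r) x₀ := fun r => rfl
  have hgen : ∀ r x, genOp q (E.symm (-r)) x = m r - r x := fun r x => by
    have h1 : rootedOp q x₀ (E.symm (-r)) x = (-r) x := by
      rw [← hE, LinearEquiv.apply_symm_apply]
    rw [rootedOp_apply, Pi.neg_apply, ← hm] at h1
    linarith
  have hsolve : ∀ h r, (∀ x, genOp q h x - h x₀ = -r x) → m r = h x₀ := fun h r hr => by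
    have : E h = -r := by
      rw [hE]
      funext x
      rw [rootedOp_apply, hr, Pi.neg_apply]
    rw [hm, ← this, LinearEquiv.symm_apply_apply]
  have hsum : ∀ r, ∑ x, m (Pi.single x 1) * r x = m r := fun r => by
    rw [LinearMap.pi_apply_eq_sum_univ m r]
    refine Finset.sum_congr rfl fun x _ => ?_
    rw [smul_eq_mul, mul_comm]
    congr 2
    funext y
    simp [Pi.single_apply, eq_comm]
  have hnonneg : ∀ r : X → ℝ, (∀ x, 0 ≤ r x) → 0 ≤ m r := fun r hr => by
    have : -m r ≤ 0 := nonpos_of_le_genOp hq (h := -E.symm (-r)) fun x => by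
      rw [map_neg, Pi.neg_apply, hgen]
      linarith [hr x]
    linarith
  have hsingle : ∀ x y, 0 ≤ (Pi.single x 1 : X → ℝ) y := fun x y => by
    rw [Pi.single_apply]
    split_ifs <;> norm_num
  refine ⟨fun x => m (Pi.single x 1), fun x => hnonneg _ (hsingle x), ?_, fun φ => ?_,
    fun x hx => ?_, fun r => ⟨E.symm (-r), fun x => ?_⟩⟩
  · have h1 := hsum fun _ => 1
    simp only [mul_one] at h1
    rw [h1]
    exact hsolve (fun _ => 1) _ fun x => by rw [genOp_const]; simp
  · rw [hsum, hsolve (fun x => φ x₀ - φ x) _ fun x => ?_, sub_self]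
    have : (fun x => φ x₀ - φ x) = (fun _ => φ x₀) - φ := rfl
    rw [this, map_sub, genOp_const]
    simp
  · refine lt_of_le_of_ne (hnonneg _ (hsingle x)) fun h0 => ?_
    replace h0 : 0 = m (Pi.single x 1) := h0
    have e : ∀ y, genOp q (-E.symm (-Pi.single x 1)) y = (Pi.single x 1 : X → ℝ) y := fun y => by
      rw [map_neg, Pi.neg_apply, hgen, ← h0]
      ring
    have sub : ∀ y, 0 ≤ genOp q (-E.symm (-Pi.single x 1)) y := fun y => by
      rw [e]; exact hsingle x y
    have top := le_root_of_subharmonic hq hroot sub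
    have hxm := eq_of_max_of_reachable hq sub top hx
    have := genOp_nonpos_of_max hq (x := x) fun y => (top y).trans hxm.ge
    rw [e, Pi.single_eq_same] at this
    linarith
  · rw [hsum, hgen]

end Chain

theorem norm_exp_le {A : Type*} [NormedRing A] [NormedAlgebra ℝ A] [CompleteSpace A]
    [NormOneClass A] (x : A) : ‖NormedSpace.exp x‖ ≤ Real.exp ‖x‖ := by
  rw [NormedSpace.exp_eq_tsum ℝ, Real.exp_eq_exp_ℝ]
  refine tsum_of_norm_bounded (NormedSpace.expSeries_div_hasSum_exp ‖x‖) fun n => ?_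
  rw [norm_smul, norm_inv, Real.norm_natCast, div_eq_inv_mul]
  gcongr
  exact norm_pow_le x n

section MatrixExp

variable {Y : Type*} [Fintype Y] [DecidableEq Y]

attribute [local instance] Matrix.linftyOpNormedRing Matrix.linftyOpNormedAlgebra

theorem hasDerivAt_exp_smul_mulVec (Q : Matrix Y Y ℝ) (H : Y → ℝ) (y : Y) (u : ℝ) :
    HasDerivAt (fun u : ℝ => (NormedSpace.exp (u • Q)).mulVec H y)
      ((NormedSpace.exp (u • Q)).mulVec (Q.mulVec H) y) u := by
  have h := hasDerivAt_exp_smul_const (𝕂 := ℝ) Q u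
  let l : Matrix Y Y ℝ →ₗ[ℝ] ℝ :=
    { toFun := fun A => A.mulVec H y
      map_add' := fun A B => by simp [Matrix.add_mulVec]
      map_smul' := fun c A => by simp [Matrix.smul_mulVec] }
  have h2 := (LinearMap.toContinuousLinearMap l).hasFDerivAt.comp_hasDerivAt u h
  rw [Matrix.mulVec_mulVec]
  exact h2

theorem exp_smul_mulVec_one {Q : Matrix Y Y ℝ} (hsum : ∀ y, ∑ z, Q y z = 0) (u : ℝ) (y : Y) :
    ∑ z, NormedSpace.exp (u • Q) y z = 1 := by
  have hQ : Q.mulVec (fun _ => 1) = 0 := by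
    funext y
    simp [Matrix.mulVec, dotProduct, hsum]
  have hd := hasDerivAt_exp_smul_mulVec Q (fun _ => 1) y
  rw [hQ] at hd
  have h := is_const_of_deriv_eq_zero (fun u => (hd u).differentiableAt)
    (fun u => by rw [(hd u).deriv, Matrix.mulVec_zero]; rfl) u 0
  simpa [Matrix.mulVec, dotProduct, NormedSpace.exp_zero, Matrix.one_apply] using h

/-- The semigroup of a conservative matrix with nonnegative off-diagonal entries is contractive
in the supremum norm. -/
theorem norm_exp_smul_le_one {Q : Matrix Y Y ℝ} (hoff : ∀ y z, y ≠ z → 0 ≤ Q y z)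
    (hsum : ∀ y, ∑ z, Q y z = 0) {u : ℝ} (hu : 0 ≤ u) :
    ‖NormedSpace.exp (u • Q)‖ ≤ 1 := by
  rcases isEmpty_or_nonempty Y with hY | hY
  · rw [Subsingleton.elim (NormedSpace.exp (u • Q)) 0, norm_zero]
    exact zero_le_one
  have : NormOneClass (Matrix Y Y ℝ) := Matrix.linfty_opNormOneClass
  set c : ℝ := ∑ y, |Q y y| with hc
  have hcy : ∀ y, 0 ≤ Q y y + c := fun y => by
    have h1 : |Q y y| ≤ c :=
      Finset.single_le_sum (f := fun y => |Q y y|) (fun y _ => abs_nonneg _) (Finset.mem_univ y)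
    linarith [neg_abs_le (Q y y)]
  have hc0 : 0 ≤ c := Finset.sum_nonneg fun y _ => abs_nonneg _
  set B : Matrix Y Y ℝ := u • Q + algebraMap ℝ _ (u * c) with hB
  have hentry : ∀ y z, B y z = u * (Q y z + if y = z then c else 0) := fun y z => by
    simp only [hB, Matrix.add_apply, Matrix.smul_apply, Matrix.algebraMap_matrix_apply, smul_eq_mul]
    split_ifs <;> simp [mul_add]
  have hBnn : ∀ y z, 0 ≤ B y z := fun y z => by
    rw [hentry]
    refine mul_nonneg hu ?_
    split_ifs with h
    · subst h; exact hcy y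
    · simpa using hoff y z h
  have hBn : ‖B‖ ≤ u * c := by
    lift u * c to NNReal using mul_nonneg hu hc0 with d hd
    rw [Matrix.linfty_opNorm_def, NNReal.coe_le_coe]
    refine Finset.sup_le fun y _ => ?_
    rw [← NNReal.coe_le_coe]
    push_cast
    rw [hd]
    simp_rw [Real.norm_of_nonneg (hBnn y _), hentry, ← Finset.mul_sum, Finset.sum_add_distrib,
      hsum]
    simp
  have hQ : u • Q = B + algebraMap ℝ _ (-(u * c)) := by
    rw [hB, map_neg]; abel
  have hcomm : Commute B (algebraMap ℝ _ (-(u * c))) := (Algebra.commutes _ _).symm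
  have hexp : NormedSpace.exp (algebraMap ℝ (Matrix Y Y ℝ) (-(u * c))) =
      algebraMap ℝ (Matrix Y Y ℝ) (NormedSpace.exp (-(u * c))) :=
    (NormedSpace.algebraMap_exp_comm (-(u * c))).symm
  rw [hQ, Matrix.exp_add_of_commute _ _ hcomm, hexp, ← Real.exp_eq_exp_ℝ]
  calc _ ≤ ‖NormedSpace.exp B‖ * ‖algebraMap ℝ (Matrix Y Y ℝ) (Real.exp (-(u * c)))‖ :=
        norm_mul_le _ _
    _ ≤ Real.exp (u * c) * Real.exp (-(u * c)) := by
        rw [norm_algebraMap', Real.norm_of_nonneg (Real.exp_nonneg _)]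
        gcongr
        exact (norm_exp_le B).trans (Real.exp_le_exp.2 hBn)
    _ = 1 := by rw [← Real.exp_add, add_neg_cancel, Real.exp_zero]

/-- If `Q H = v - r` then the time average of `exp (u Q) r` tends to `v`. -/
theorem tendsto_average_of_poisson {Q : Matrix Y Y ℝ} (hoff : ∀ y z, y ≠ z → 0 ≤ Q y z)
    (hsum : ∀ y, ∑ z, Q y z = 0) {H r : Y → ℝ} {v : ℝ}
    (hP : ∀ y, ∑ z, Q y z * H z = v - r y) (y : Y) :
    Tendsto (fun t : ℝ => (1 / t) * ∫ u in (0 : ℝ)..t, ∑ z, NormedSpace.exp (u • Q) y z * r z)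
      atTop (𝓝 v) := by
  set G : ℝ → ℝ := fun u => (NormedSpace.exp (u • Q)).mulVec H y with hG
  have hdG : ∀ u, HasDerivAt G (v - ∑ z, NormedSpace.exp (u • Q) y z * r z) u := fun u => by
    have h := hasDerivAt_exp_smul_mulVec Q H y u
    convert h using 1
    have hQH : Q.mulVec H = fun y => v - r y := funext hP
    rw [hQH]
    simp only [Matrix.mulVec, dotProduct, mul_sub, Finset.sum_sub_distrib, ← Finset.sum_mul,
      exp_smul_mulVec_one hsum, one_mul]
  have hdF : ∀ u, HasDerivAt (fun u => v * u - G u)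
      (∑ z, NormedSpace.exp (u • Q) y z * r z) u := fun u => by
    have h := ((hasDerivAt_id u).const_mul v).sub (hdG u)
    rw [mul_one, sub_sub_cancel] at h
    exact h
  have hcont : Continuous fun u : ℝ => ∑ z, NormedSpace.exp (u • Q) y z * r z :=
    continuous_iff_continuousAt.2 fun u => (hasDerivAt_exp_smul_mulVec Q r y u).continuousAt
  have hint : ∀ t, ∫ u in (0 : ℝ)..t, ∑ z, NormedSpace.exp (u • Q) y z * r z =
      v * t - (G t - G 0) := fun t => by
    rw [intervalIntegral.integral_eq_sub_of_hasDerivAt (fun u _ => hdF u)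
      (hcont.intervalIntegrable _ _)]
    ring
  have hbound : ∀ t, 0 ≤ t → |G t - G 0| ≤ ‖H‖ + ‖H‖ := fun t ht => by
    have hb : ∀ t, 0 ≤ t → |G t| ≤ ‖H‖ := fun t ht =>
      calc |G t| ≤ ‖(NormedSpace.exp (t • Q)).mulVec H‖ :=
          norm_le_pi_norm ((NormedSpace.exp (t • Q)).mulVec H) y
        _ ≤ ‖NormedSpace.exp (t • Q)‖ * ‖H‖ := Matrix.linfty_opNorm_mulVec _ _
        _ ≤ 1 * ‖H‖ := by
          gcongr
          exact norm_exp_smul_le_one hoff hsum ht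
        _ = ‖H‖ := one_mul _
    exact (abs_sub _ _).trans (add_le_add (hb t ht) (hb 0 le_rfl))
  have hlim : Tendsto (fun t : ℝ => v - (G t - G 0) * t⁻¹) atTop (𝓝 (v - 0)) := by
    refine tendsto_const_nhds.sub (squeeze_zero_norm' (a := fun t : ℝ => (‖H‖ + ‖H‖) * t⁻¹) ?_ ?_)
    · filter_upwards [eventually_gt_atTop 0] with t ht
      rw [norm_mul, Real.norm_eq_abs, Real.norm_of_nonneg (inv_nonneg.2 ht.le)]
      exact mul_le_mul_of_nonneg_right (hbound t ht.le) (inv_nonneg.2 ht.le)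
    · simpa using tendsto_inv_atTop_zero.const_mul (‖H‖ + ‖H‖)
  rw [sub_zero] at hlim
  refine hlim.congr' ?_
  filter_upwards [eventually_gt_atTop 0] with t ht
  rw [hint]
  field_simp

end MatrixExp

open Event Act

/-- A state with a data user in LTE whose throughput would be higher in WiFi. -/
def Misplaced (kth : ℕ) (s : Triple) : Prop := 0 < s.j ∧ s.k < kth

open Classical in
/-- Move one misplaced LTE data user, if any, to WiFi. -/
noncomputable def offload (kth : ℕ) (s : Triple) : Triple :=
  if Misplaced kth s then ⟨s.i, s.j - 1, s.k + 1⟩ else s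

theorem offload_eq_of_misplaced {kth : ℕ} {s : Triple} (h : Misplaced kth s) :
    offload kth s = ⟨s.i, s.j - 1, s.k + 1⟩ := if_pos h

theorem offload_eq_self {kth : ℕ} {s : Triple} (h : ¬ Misplaced kth s) : offload kth s = s :=
  if_neg h

theorem eq_offload_iff {kth : ℕ} {s t : Triple} : t = offload kth s ↔ t.i = s.i ∧
    (0 < s.j ∧ s.k < kth ∧ t.j = s.j - 1 ∧ t.k = s.k + 1 ∨
      (s.j = 0 ∨ kth ≤ s.k) ∧ t.j = s.j ∧ t.k = s.k) := by
  unfold offload Misplaced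
  split_ifs with h <;> rw [Triple.ext_iff]
  · dsimp only
    omega
  · omega

/-- Whether the event is the departure of a data user. -/
def IsDataDeparture : Event → Prop
  | E4 => True
  | E5 => True
  | _ => False

/-- Events which the coupling of a state with its offloaded state may identify. -/
def Matches (e e' : Event) : Prop := e = e' ∨ (IsDataDeparture e ∧ IsDataDeparture e')

variable {p : Params} {kth : ℕ}

theorem offload_mem (hW : kth ≤ p.W) {s : Triple} (hs : s ∈ p.states) :
    offload kth s ∈ p.states := by
  by_cases h : Misplaced kth s
  · rw [offload_eq_of_misplaced h, Params.mem_states]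
    rw [Params.mem_states] at hs
    have := h.2
    simp only
    omega
  · rwa [offload_eq_self h]

theorem f_lt_f_offload (hk : p.IsThreshold kth) {s : Triple} (h : Misplaced kth s) :
    p.f s < p.f (offload kth s) := by
  rw [offload_eq_of_misplaced h]
  have h1 := hk.2 s.k h.2
  have h2 : ((s.j - 1 : ℕ) : ℝ) = s.j - 1 := by rw [Nat.cast_sub h.1]; simp
  simp only [Params.f, Params.incWD] at *
  rw [h2]
  push_cast
  linarith

theorem f_le_f_offload (hk : p.IsThreshold kth) (s : Triple) : p.f s ≤ p.f (offload kth s) := by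
  by_cases h : Misplaced kth s
  · exact (f_lt_f_offload hk h).le
  · rw [offload_eq_self h]

/-- Every action in `s` can be imitated in the offloaded state, so that the offloaded state of the
successor is reached, with the same decision on blocking voice users. -/
theorem exists_imitating_act (hW : kth ≤ p.W) {s : Triple} (hs : s ∈ p.states) {e e' : Event}
    {a : Act} (hm : Matches e e') (hpos : Possible (offload kth s) e) (hf : p.Feasible s e' a) :
    ∃ a', p.Feasible (offload kth s) e a' ∧
      next (offload kth s) e a' = offload kth (next s e' a) ∧ cost e a' = cost e' a := by
  obtain ⟨i, j, k⟩ := s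
  rw [Params.mem_states] at hs
  have key : ∀ P : Act → Prop, (P A1 ∨ P A2 ∨ P A3 ∨ P A4 ∨ P A5) → ∃ a, P a := by
    rintro P (h | h | h | h | h) <;> exact ⟨_, h⟩
  apply key
  by_cases hb : 0 < j ∧ k < kth
  · rw [offload_eq_of_misplaced (s := ⟨i, j, k⟩) hb] at hpos ⊢
    cases e <;> cases e' <;> simp [Matches, IsDataDeparture] at hm <;> cases a <;>
      simp [Params.Feasible, Possible, eq_offload_iff, next, cost] at hf hpos hs ⊢ <;> omega
  · rw [offload_eq_self (s := ⟨i, j, k⟩) hb] at hpos ⊢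
    cases e <;> cases e' <;> simp [Matches, IsDataDeparture] at hm <;> cases a <;>
      simp [Params.Feasible, Possible, eq_offload_iff, next, cost] at hf hpos hs ⊢ <;> omega

/-- Mixing weights: the chance that event `e` in the offloaded state of `s` imitates event `e'`
in `s`. -/
noncomputable def mixWeight (s : Triple) : Event → Event → ℝ
  | E1, E1 => 1
  | E2, E2 => 1
  | E3, E3 => 1
  | E4, E4 => s.j / (s.j + s.k)
  | E4, E5 => s.k / (s.j + s.k)
  | E5, E4 => s.j / (s.j + s.k)
  | E5, E5 => s.k / (s.j + s.k)
  | _, _ => 0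

theorem sum_event {A : Type*} [AddCommMonoid A] (g : Event → A) :
    ∑ e, g e = g E1 + g E2 + g E3 + g E4 + g E5 := by
  have : (Finset.univ : Finset Event) = {E1, E2, E3, E4, E5} := rfl
  rw [this]
  simp [add_assoc]

theorem mixWeight_nonneg (s : Triple) (e e' : Event) : 0 ≤ mixWeight s e e' := by
  cases e <;> cases e' <;> simp only [mixWeight] <;> positivity

theorem matches_of_mixWeight_ne_zero {s : Triple} {e e' : Event} (h : mixWeight s e e' ≠ 0) :
    Matches e e' := by
  cases e <;> cases e' <;> simp [mixWeight, Matches, IsDataDeparture] at *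

theorem possible_of_mixWeight_ne_zero {s : Triple} {e e' : Event} (h : mixWeight s e e' ≠ 0)
    (he : Possible (offload kth s) e) : Possible s e' := by
  cases e <;> cases e' <;>
    simp only [mixWeight, ne_eq, not_true_eq_false, div_eq_zero_iff, not_or, Nat.cast_eq_zero] at h <;>
    simp only [Possible] at * <;> try omega
  by_cases hb : Misplaced kth s
  · rwa [offload_eq_of_misplaced hb] at he
  · rwa [offload_eq_self hb] at he

theorem offload_i (s : Triple) : (offload kth s).i = s.i := by
  unfold offload; split_ifs <;> rfl

theorem offload_j_add_k (s : Triple) :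
    (offload kth s).j + (offload kth s).k = s.j + s.k := by
  unfold offload Misplaced; split_ifs
  · simp only; omega
  · rfl

theorem data_pos_of_possible {s : Triple} {e : Event} (he : Possible (offload kth s) e)
    (hd : IsDataDeparture e) : 0 < s.j + s.k := by
  have := offload_j_add_k (kth := kth) s
  cases e <;> simp only [IsDataDeparture, Possible] at * <;> omega

theorem sum_mixWeight {s : Triple} {e : Event} (he : Possible (offload kth s) e) :
    ∑ e', mixWeight s e e' = 1 := by
  have h : IsDataDeparture e → (s.j : ℝ) / (s.j + s.k) + s.k / (s.j + s.k) = 1 := fun hd => by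
    have : (0 : ℝ) < s.j + s.k := by exact_mod_cast data_pos_of_possible he hd
    field_simp
  rw [sum_event]
  cases e <;> simp [mixWeight] <;> exact h trivial

theorem sum_rate_mul_mixWeight (s : Triple) (e' : Event) :
    ∑ e, p.rate (offload kth s) e * mixWeight s e e' = p.rate s e' := by
  have hi := offload_i (kth := kth) s
  have hjk : ((offload kth s).j : ℝ) + (offload kth s).k = s.j + s.k := by
    exact_mod_cast offload_j_add_k s
  have h : ∀ x : ℝ, (s.j + s.k = (0 : ℝ) → x = 0) →
      (offload kth s).j * p.muD * (x / (s.j + s.k)) +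
        (offload kth s).k * p.muD * (x / (s.j + s.k)) = x * p.muD := fun x hx => by
    rw [← add_mul, ← add_mul, hjk]
    by_cases h0 : (s.j : ℝ) + s.k = 0
    · rw [hx h0]; simp
    · field_simp
  have hj : (0 : ℝ) ≤ s.j := Nat.cast_nonneg _
  have hk : (0 : ℝ) ≤ s.k := Nat.cast_nonneg _
  rw [sum_event]
  cases e' <;> simp [mixWeight, Params.rate, hi] <;> apply h <;> intro h0 <;> linarith

theorem totalRate_offload (s : Triple) : p.totalRate (offload kth s) = p.totalRate s := by
  have hi := offload_i (kth := kth) s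
  have hjk : ((offload kth s).j : ℝ) + (offload kth s).k = s.j + s.k := by
    exact_mod_cast offload_j_add_k s
  simp only [Params.totalRate, sum_event, Params.rate, hi, add_assoc, ← add_mul, hjk]

/-- A sum over the events in `s` regrouped by the events in the offloaded state. -/
theorem sum_rate_regroup (s : Triple) (g : Event → ℝ) :
    ∑ e', p.rate s e' * g e' =
      ∑ e, p.rate (offload kth s) e * ∑ e', mixWeight s e e' * g e' := by
  simp_rw [← sum_rate_mul_mixWeight (p := p) (kth := kth) s, Finset.sum_mul, Finset.mul_sum]
  rw [Finset.sum_comm]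
  exact Finset.sum_congr rfl fun e _ => Finset.sum_congr rfl fun e' _ => by ring

theorem rate_eq_zero_of_not_possible {s : Triple} {e : Event} (h : ¬ Possible s e) :
    p.rate s e = 0 := by
  cases e <;> simp [Possible, Params.rate] at * <;> simp [h]

theorem exists_feasible (hC : 0 < p.C) {s : Triple} {e : Event} (he : Possible s e) :
    ∃ a, p.Feasible s e a := by
  by_cases h : s.i + s.j = p.C
  · cases e
    · refine ⟨A1, ?_⟩
      rintro rfl
      simp only at h
      omega
    · by_cases hk : s.k = p.W
      · exact ⟨A1, h, hk⟩
      · exact ⟨A3, hk⟩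
    all_goals exact ⟨A1, Nat.pos_iff_ne_zero.1 he⟩
  · cases e
    · exact ⟨A2, h⟩
    · exact ⟨A2, h⟩
    all_goals exact ⟨A1, Nat.pos_iff_ne_zero.1 he⟩

theorem qval_le_maxq {β : ℝ} {V : Triple → ℝ} {s : Triple} {e : Event} {a : Act}
    (ha : p.Feasible s e a) : p.qval β V s e a ≤ p.maxq β V s e := by
  refine le_csSup (Set.Finite.bddAbove ((Set.finite_range (p.qval β V s e)).subset ?_)) ⟨a, ha, rfl⟩
  rintro x ⟨a, _, rfl⟩
  exact ⟨a, rfl⟩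

theorem maxq_le_add_maxq_offload (hW : kth ≤ p.W) {β c : ℝ} {V : Triple → ℝ}
    (hV : ∀ t ∈ p.states, p.f t + V t ≤ c + (p.f (offload kth t) + V (offload kth t)))
    (hC : 0 < p.C) {s : Triple} (hs : s ∈ p.states) {e e' : Event} (hm : Matches e e')
    (he : Possible (offload kth s) e) (he' : Possible s e') :
    p.maxq β V s e' ≤ c + p.maxq β V (offload kth s) e := by
  refine csSup_le ?_ ?_
  · obtain ⟨a, ha⟩ := exists_feasible hC he'
    exact ⟨_, a, ha, rfl⟩
  · rintro x ⟨a, ha, rfl⟩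
    obtain ⟨a', hf, hn, hc⟩ := exists_imitating_act hW hs hm he ha
    have h1 := qval_le_maxq (β := β) (V := V) hf
    have h2 := hV _ (next_mem p s hs e' a ha)
    simp only [Params.qval, Params.reward, hn, hc] at h1 ⊢
    linarith

theorem bellman_le_bellman_offload (hW : kth ≤ p.W) (hrate : ∀ s e, 0 ≤ p.rate s e)
    {δ β c : ℝ} (hδ : 0 ≤ δ) {V : Triple → ℝ}
    (hV : ∀ t ∈ p.states, p.f t + V t ≤ c + (p.f (offload kth t) + V (offload kth t)))
    (hC : 0 < p.C) {s : Triple} (hs : s ∈ p.states) :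
    p.bellman δ β V s ≤ p.bellman δ β V (offload kth s) + p.totalRate s * δ * c +
      (1 - p.totalRate s * δ) * (V s - V (offload kth s)) := by
  have hmain : ∑ e', p.rate s e' * p.maxq β V s e' ≤
      ∑ e, p.rate (offload kth s) e * (c + p.maxq β V (offload kth s) e) := by
    rw [sum_rate_regroup (kth := kth)]
    refine Finset.sum_le_sum fun e _ => ?_
    by_cases he : Possible (offload kth s) e
    · refine mul_le_mul_of_nonneg_left ?_ (hrate _ _)
      calc _ ≤ ∑ e', mixWeight s e e' * (c + p.maxq β V (offload kth s) e) := by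
            refine Finset.sum_le_sum fun e' _ => ?_
            by_cases hw : mixWeight s e e' = 0
            · rw [hw, zero_mul, zero_mul]
            · exact mul_le_mul_of_nonneg_left (maxq_le_add_maxq_offload hW hV hC hs
                (matches_of_mixWeight_ne_zero hw) he (possible_of_mixWeight_ne_zero hw he))
                (mixWeight_nonneg _ _ _)
        _ = _ := by rw [← Finset.sum_mul, sum_mixWeight he, one_mul]
    · rw [rate_eq_zero_of_not_possible he, zero_mul, zero_mul]
  simp_rw [mul_add, Finset.sum_add_distrib, ← Finset.sum_mul] at hmain
  have htot : ∑ e, p.rate (offload kth s) e = p.totalRate s := totalRate_offload s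
  have htot' : ∑ e, p.rate s e = p.totalRate s := rfl
  have hpull : ∀ t, ∑ e, p.rate t e * δ * p.maxq β V t e =
      δ * ∑ e, p.rate t e * p.maxq β V t e := fun t => by
    rw [Finset.mul_sum]
    exact Finset.sum_congr rfl fun e _ => by ring
  simp only [Params.bellman, hpull, ← Finset.sum_mul, htot, htot']
  rw [htot] at hmain
  linarith [mul_le_mul_of_nonneg_left hmain hδ]

theorem rate_nonneg (hlamV : 0 < p.lamV) (hlamD : 0 < p.lamD) (hmuV : 0 < p.muV)
    (hmuD : 0 < p.muD) (s : Triple) (e : Event) : 0 ≤ p.rate s e := by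
  cases e <;> simp only [Params.rate] <;> positivity

theorem totalRate_pos (hrate : ∀ s e, 0 ≤ p.rate s e) (hlamV : 0 < p.lamV) (s : Triple) :
    0 < p.totalRate s :=
  hlamV.trans_le
    (Finset.single_le_sum (f := p.rate s) (fun e _ => hrate s e) (Finset.mem_univ E1))

theorem capacity_pos_of_misplaced {s : Triple} (hs : s ∈ p.states) (h : Misplaced kth s) :
    0 < p.C := by
  rw [Params.mem_states] at hs
  have := h.1
  omega

theorem valueIter_le_offload (hk : p.IsThreshold kth) (hW : kth ≤ p.W)
    (hrate : ∀ s e, 0 ≤ p.rate s e) {δ : ℝ} (hδ : 0 < δ)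
    (hunif : ∀ s ∈ p.states, p.totalRate s * δ ≤ 1) (β : ℝ) (n : ℕ) :
    ∀ s ∈ p.states, p.valueIter δ β n s ≤ p.valueIter δ β n (offload kth s) := by
  induction n with
  | zero => exact fun s _ => le_rfl
  | succ n ih =>
    intro s hs
    by_cases h : Misplaced kth s
    · have h1 := bellman_le_bellman_offload (c := 0) (β := β) (V := p.valueIter δ β n) hW hrate hδ.le
        (fun t ht => by linarith [ih t ht, f_le_f_offload hk t])
        (capacity_pos_of_misplaced hs h) hs
      have h2 := mul_nonneg (sub_nonneg.2 (hunif s hs)) (sub_nonneg.2 (ih s hs))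
      simp only [Params.valueIter]
      linarith
    · rw [offload_eq_self h]

theorem dpSolution_le_offload (hk : p.IsThreshold kth) (hW : kth ≤ p.W)
    (hrate : ∀ s e, 0 ≤ p.rate s e) (hlamV : 0 < p.lamV) {δ : ℝ} (hδ : 0 < δ)
    {β g : ℝ} {V : Triple → ℝ}
    (hV : p.IsDPSolution δ β g V) : ∀ s ∈ p.states, V s ≤ V (offload kth s) := by
  intro s₀ hs₀
  obtain ⟨s, hs, hmax⟩ := p.states.exists_max_image (fun s => V s - V (offload kth s)) ⟨s₀, hs₀⟩
  obtain ⟨t, ht, htmax⟩ := p.states.exists_max_image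
    (fun s => (p.f s + V s) - (p.f (offload kth s) + V (offload kth s))) ⟨s₀, hs₀⟩
  by_contra hlt
  have hm : 0 < V s - V (offload kth s) := by linarith [hmax s₀ hs₀, not_le.1 hlt]
  have hmis : Misplaced kth s := by
    by_contra h
    rw [offload_eq_self h, sub_self] at hm
    exact lt_irrefl _ hm
  set c := max 0 ((p.f t + V t) - (p.f (offload kth t) + V (offload kth t))) with hc
  have hct : (p.f t + V t) - (p.f (offload kth t) + V (offload kth t)) ≤ c := le_max_right _ _
  have hcm : c < V s - V (offload kth s) := by
    refine max_lt hm ?_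
    by_cases h : Misplaced kth t
    · linarith [hmax t ht, f_lt_f_offload hk h]
    · rw [offload_eq_self h]
      linarith
  have h1 := bellman_le_bellman_offload (c := c) (β := β) (V := V) hW hrate hδ.le
    (fun x hx => by linarith [htmax x hx, hct])
    (capacity_pos_of_misplaced hs hmis) hs
  rw [← hV s hs, ← hV _ (offload_mem hW hs)] at h1
  have hpos : 0 < p.totalRate s * δ := mul_pos (totalRate_pos hrate hlamV s) hδ
  linarith [mul_lt_mul_of_pos_left hcm hpos]

theorem isMaximizer_iff_eq {β : ℝ} {V : Triple → ℝ} {s : Triple} {e : Event} {a₀ : Act}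
    (h₀ : p.Feasible s e a₀)
    (h : ∀ a, p.Feasible s e a → a ≠ a₀ → p.qval β V s e a < p.qval β V s e a₀) (a : Act) :
    p.IsMaximizer β V s e a ↔ a = a₀ := by
  constructor
  · rintro ⟨hf, hmax⟩
    by_contra hne
    exact absurd (hmax a₀ h₀) (not_le.2 (h a hf hne))
  · rintro rfl
    refine ⟨h₀, fun a' ha' => ?_⟩
    by_cases hne : a' = a
    · rw [hne]
    · exact (h a' ha' hne).le

theorem qval_lt_qval_of_offload (hk : p.IsThreshold kth) {β : ℝ} {V : Triple → ℝ}
    (hV : ∀ s ∈ p.states, V s ≤ V (offload kth s)) {s : Triple} (hs : s ∈ p.states) {e : Event}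
    {a a' : Act} (ha : p.Feasible s e a) (hmis : Misplaced kth (next s e a))
    (hnext : next s e a' = offload kth (next s e a)) (hcost : cost e a' = cost e a) :
    p.qval β V s e a < p.qval β V s e a' := by
  simp only [Params.qval, Params.reward, hnext, hcost]
  linarith [f_lt_f_offload hk hmis, hV _ (next_mem p s hs e a ha)]

/-- A value function that does not decrease under offloading favours WiFi. -/
theorem servesOnWiFi_of_le_offload (hk : p.IsThreshold kth) (hW : kth ≤ p.W) {β : ℝ}
    {V : Triple → ℝ} (hV : ∀ s ∈ p.states, V s ≤ V (offload kth s)) :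
    p.ServesOnWiFi kth β V := by
  intro s hs hC hjk
  have key : ∀ {e a a'}, p.Feasible s e a → Misplaced kth (next s e a) →
      next s e a' = offload kth (next s e a) → cost e a' = cost e a →
      p.qval β V s e a < p.qval β V s e a' := fun h1 h2 h3 h4 =>
    qval_lt_qval_of_offload hk hV hs h1 h2 h3 h4
  obtain ⟨i, j, k⟩ := s
  simp only at hC hjk ⊢
  refine ⟨fun h => ?_, fun h => ?_, fun h => ?_, fun h hj => ?_, fun h hj => ?_⟩ <;>
    refine isMaximizer_iff_eq (by simp only [Params.Feasible]; omega) fun a ha hne => ?_ <;>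
    cases a <;> simp only [Params.Feasible, ne_eq, not_true_eq_false, reduceCtorEq] at ha hne <;>
    first
    | omega
    | exact key (by simp only [Params.Feasible]; omega) (by simp only [Misplaced, next]; omega)
        (by simp [eq_offload_iff, next]; omega) (by simp [cost])

/-- Expected rate of change of `φ` in state `s` under `M`. -/
noncomputable def Policy.drift (M : Policy p) (φ : Triple → ℝ) (s : p.State) : ℝ :=
  ∑ e, ∑ a, p.rate s.1 e * M.prob s e a * (φ (next s.1 e a) - φ s.1)

/-- Transition rates between system states under `M`. -/
noncomputable def Policy.transRate (M : Policy p) (s s' : p.State) : ℝ :=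
  ∑ e, ∑ a, p.rate s.1 e * M.prob s e a * (if s'.1 = next s.1 e a then 1 else 0)

/-- `π` is a stationary distribution of the system state under `M`. -/
structure Policy.IsStationary (M : Policy p) (π : p.State → ℝ) : Prop where
  nonneg : ∀ s, 0 ≤ π s
  sum_one : ∑ s, π s = 1
  balance : ∀ φ : Triple → ℝ, ∑ s, π s * M.drift φ s = 0

theorem Policy.rate_mul_sum_prob (M : Policy p) (s : p.State) (e : Event) :
    p.rate s.1 e * ∑ a, M.prob s e a = p.rate s.1 e := by
  by_cases h : Possible s.1 e
  · rw [M.sum_one s e h, mul_one]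
  · rw [rate_eq_zero_of_not_possible h, zero_mul]

theorem Policy.sum_ite_next (M : Policy p) {s : p.State} {e : Event} {a : Act} (c : ℝ)
    (φ : Triple → ℝ) :
    ∑ s' : p.State, c * M.prob s e a * (if s'.1 = next s.1 e a then 1 else 0) * φ s'.1 =
      c * M.prob s e a * φ (next s.1 e a) := by
  by_cases h : M.prob s e a = 0
  · simp [h]
  · rw [Finset.sum_eq_single (⟨_, next_mem p s.1 s.2 e a (M.feasible s e a h)⟩ : p.State)]
    · simp
    · intro b _ hb
      rw [if_neg fun hbn => hb (Subtype.ext hbn), mul_zero, zero_mul]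
    · simp

theorem Policy.genOp_transRate (M : Policy p) (φ : Triple → ℝ) (s : p.State) :
    genOp M.transRate (fun s => φ s.1) s = M.drift φ s := by
  have h := fun e a => M.sum_ite_next (s := s) (e := e) (a := a) (p.rate s.1 e) fun t => φ t - φ s.1
  simp only [genOp_apply, Policy.transRate, Policy.drift, Finset.sum_mul, ← h]
  rw [Finset.sum_comm]
  exact Finset.sum_congr rfl fun e _ => Finset.sum_comm

theorem Policy.gen_sum (M : Policy p) (Φ : Triple → Bool → ℝ) (y : p.State × Bool) :
    ∑ z, M.gen y z * Φ z.1.1 z.2 = ∑ e, ∑ a, p.rate y.1.1 e * M.prob y.1 e a *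
      (Φ (next y.1.1 e a) (decide (e = E1 ∧ a = A1)) - Φ y.1.1 y.2) := by
  simp only [Policy.gen, Finset.sum_mul]
  rw [Finset.sum_comm]
  refine Finset.sum_congr rfl fun e _ => ?_
  rw [Finset.sum_comm]
  refine Finset.sum_congr rfl fun a _ => ?_
  simp only [mul_sub, sub_mul, Finset.sum_sub_distrib]
  congr 1
  · rw [← M.sum_ite_next (p.rate y.1.1 e) fun t => Φ t (decide (e = E1 ∧ a = A1)),
      Fintype.sum_prod_type]
    refine Finset.sum_congr rfl fun s _ => ?_
    rw [Finset.sum_eq_single (decide (e = E1 ∧ a = A1))]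
    · simp
    · intro b _ hb
      rw [if_neg fun h => hb h.2, mul_zero, zero_mul]
    · simp
  · rw [Finset.sum_eq_single y]
    · simp
    · intro b _ hb
      simp [hb]
    · simp

theorem Policy.gen_sum_row (M : Policy p) (y : p.State × Bool) : ∑ z, M.gen y z = 0 := by
  simpa using M.gen_sum (fun _ _ => 1) y

theorem Policy.gen_nonneg (hrate : ∀ s e, 0 ≤ p.rate s e) (M : Policy p) (y z : p.State × Bool)
    (h : y ≠ z) : 0 ≤ M.gen y z := by
  refine Finset.sum_nonneg fun e _ => Finset.sum_nonneg fun a _ => ?_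
  refine mul_nonneg (mul_nonneg (hrate _ _) (M.nonneg _ _ _)) ?_
  rw [if_neg h.symm, sub_zero]
  split_ifs <;> norm_num

theorem Policy.transRate_nonneg (hrate : ∀ s e, 0 ≤ p.rate s e) (M : Policy p) (s s' : p.State) :
    0 ≤ M.transRate s s' := by
  refine Finset.sum_nonneg fun e _ => Finset.sum_nonneg fun a _ => ?_
  refine mul_nonneg (mul_nonneg (hrate _ _) (M.nonneg _ _ _)) ?_
  split_ifs <;> norm_num

theorem Policy.transRate_pos (hrate : ∀ s e, 0 ≤ p.rate s e) (M : Policy p) {s s' : p.State}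
    (h : M.Step s s') : 0 < M.transRate s s' := by
  obtain ⟨e, a, he, ha, hn⟩ := h
  have hterm : ∀ e a, 0 ≤ p.rate s.1 e * M.prob s e a * (if s'.1 = next s.1 e a then 1 else 0) :=
    fun e a => mul_nonneg (mul_nonneg (hrate _ _) (M.nonneg _ _ _)) (by split_ifs <;> norm_num)
  refine Finset.sum_pos' (fun e _ => Finset.sum_nonneg fun a _ => hterm e a)
    ⟨e, Finset.mem_univ e, Finset.sum_pos' (fun a _ => hterm e a) ⟨a, Finset.mem_univ a, ?_⟩⟩
  rw [if_pos hn, mul_one]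
  exact mul_pos he ha

/-- The empty system. -/
def Params.emptyState (p : Params) : p.State := ⟨⟨0, 0, 0⟩, by rw [Params.mem_states]; simp⟩

theorem Policy.exists_step (M : Policy p) {s : p.State} {e : Event} (he : Possible s.1 e)
    (hr : 0 < p.rate s.1 e) :
    ∃ a, p.Feasible s.1 e a ∧ ∃ s', M.Step s s' ∧ s'.1 = next s.1 e a := by
  obtain ⟨a, _, ha⟩ : ∃ a ∈ Finset.univ, 0 < M.prob s e a := by
    by_contra! h
    have := M.sum_one s e he ▸ Finset.sum_nonpos h
    linarith
  have hf := M.feasible s e a ha.ne'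
  exact ⟨a, hf, ⟨_, next_mem p s.1 s.2 e a hf⟩, ⟨e, a, hr, ha, rfl⟩, rfl⟩

theorem Policy.reachable_emptyState (hmuV : 0 < p.muV) (hmuD : 0 < p.muD) (M : Policy p)
    (s : p.State) : Relation.ReflTransGen M.Step s p.emptyState := by
  obtain ⟨n, hn⟩ : ∃ n, s.1.i + s.1.j + s.1.k = n := ⟨_, rfl⟩
  induction n using Nat.strong_induction_on generalizing s with
  | _ n ih =>
    by_cases h0 : n = 0
    · have : s = p.emptyState := by
        refine Subtype.ext (Triple.ext ?_ ?_ ?_) <;> simp only [Params.emptyState] <;> omega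
      rw [this]
    · have hd : ∃ e, Possible s.1 e ∧ 0 < p.rate s.1 e ∧ e ≠ E1 ∧ e ≠ E2 := by
        rcases Nat.eq_zero_or_pos s.1.i with hi | hi
        · rcases Nat.eq_zero_or_pos s.1.j with hj | hj
          · have hk : 0 < s.1.k := by omega
            exact ⟨E5, hk, mul_pos (Nat.cast_pos.2 hk) hmuD, by simp, by simp⟩
          · exact ⟨E4, hj, mul_pos (Nat.cast_pos.2 hj) hmuD, by simp, by simp⟩
        · exact ⟨E3, hi, mul_pos (Nat.cast_pos.2 hi) hmuV, by simp, by simp⟩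
      obtain ⟨e, he, hr, h1, h2⟩ := hd
      obtain ⟨a, hf, s', hstep, hs'⟩ := M.exists_step he hr
      refine Relation.ReflTransGen.head hstep (ih _ ?_ s' rfl)
      rw [hs']
      cases e <;> cases a <;> simp [Params.Feasible, next] at * <;> omega

/-- Rate of blocking a voice user in `s` times the mean time until the next event; averaged over a
stationary distribution it is the long-run average cost. -/
noncomputable def Policy.blockCost (M : Policy p) (s : p.State) : ℝ :=
  p.lamV * M.prob s E1 A1 / p.totalRate s.1

theorem Policy.exists_isStationary (hrate : ∀ s e, 0 ≤ p.rate s e) (hmuV : 0 < p.muV)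
    (hmuD : 0 < p.muD) (M : Policy p) :
    ∃ π, M.IsStationary π ∧ (∀ s, M.Recurrent s → 0 < π s) ∧
      ∀ r : p.State → ℝ, ∃ h : Triple → ℝ, ∀ s, M.drift h s = (∑ y, π y * r y) - r s := by
  have hmono : ∀ {s s'}, Relation.ReflTransGen M.Step s s' →
      Relation.ReflTransGen (fun a b => 0 < M.transRate a b) s s' := fun h =>
    Relation.ReflTransGen.mono (fun _ _ => M.transRate_pos hrate) _ _ h
  obtain ⟨π, h0, h1, hstat, hpos, hpoisson⟩ := exists_stationary (M.transRate_nonneg hrate)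
    fun s => hmono (M.reachable_emptyState hmuV hmuD s)
  refine ⟨π, ⟨h0, h1, fun φ => ?_⟩, fun s hs => ?_, fun r => ?_⟩
  · simpa only [M.genOp_transRate] using hstat fun s => φ s.1
  · exact hpos s (hmono (hs _ (M.reachable_emptyState hmuV hmuD s)))
  · obtain ⟨h, hh⟩ := hpoisson r
    refine ⟨fun t => if ht : t ∈ p.states then h ⟨t, ht⟩ else 0, fun s => ?_⟩
    rw [← hh, ← M.genOp_transRate]
    exact congrArg (fun φ => genOp M.transRate φ s) (funext fun s => dif_pos s.2)

theorem Policy.sum_rate_mul_prob (M : Policy p) (s : p.State) :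
    ∑ e, ∑ a, p.rate s.1 e * M.prob s e a = p.totalRate s.1 := by
  simp_rw [← Finset.mul_sum, M.rate_mul_sum_prob]
  rfl

theorem Policy.IsStationary.hasAvg (hrate : ∀ s e, 0 ≤ p.rate s e) (hlamV : 0 < p.lamV)
    (hmuV : 0 < p.muV) (hmuD : 0 < p.muD) {M : Policy p} {π : p.State → ℝ}
    (hπ : M.IsStationary π) :
    M.HasAvgReward (∑ s, π s * p.f s.1) ∧ M.HasAvgCost (∑ s, π s * M.blockCost s) := by
  obtain ⟨-, hsum, hstat⟩ := hπ
  have hpoisson : ∀ r : p.State → ℝ, ∃ h : Triple → ℝ, ∀ s,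
      M.drift h s = (∑ y, π y * r y) - r s := fun r => by
    obtain ⟨π', -, -, hp⟩ := M.exists_isStationary hrate hmuV hmuD
    obtain ⟨h, hh⟩ := hp r
    have h0 := hstat h
    simp_rw [hh, mul_sub, Finset.sum_sub_distrib, ← Finset.sum_mul, hsum, one_mul] at h0
    exact ⟨h, fun s => by rw [hh]; linarith⟩
  constructor
  · obtain ⟨h, hh⟩ := hpoisson fun s => p.f s.1
    intro s
    refine tendsto_average_of_poisson (M.gen_nonneg hrate) M.gen_sum_row
      (H := fun z => h z.1.1) (r := fun z => p.f z.1.1) (fun y => ?_) (s, false)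
    rw [M.gen_sum (fun t _ => h t) y, ← hh y.1]
    rfl
  · obtain ⟨h, hh⟩ := hpoisson M.blockCost
    intro s
    refine tendsto_average_of_poisson (M.gen_nonneg hrate) M.gen_sum_row
      (H := fun z => h z.1.1 + if z.2 then (p.totalRate z.1.1)⁻¹ else 0)
      (r := fun z => if z.2 then 1 else 0) (fun y => ?_) (s, false)
    rw [M.gen_sum (fun t b => h t + if b then (p.totalRate t)⁻¹ else 0) y]
    have hsplit : ∀ e a, p.rate y.1.1 e * M.prob y.1 e a *
        ((h (next y.1.1 e a) + if decide (e = E1 ∧ a = A1) then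
          (p.totalRate (next y.1.1 e a))⁻¹ else 0) -
          (h y.1.1 + if y.2 then (p.totalRate y.1.1)⁻¹ else 0)) =
        p.rate y.1.1 e * M.prob y.1 e a * (h (next y.1.1 e a) - h y.1.1) +
        (if e = E1 then (if a = A1 then M.blockCost y.1 else 0) else 0) -
        p.rate y.1.1 e * M.prob y.1 e a * if y.2 then (p.totalRate y.1.1)⁻¹ else 0 := by
      intro e a
      by_cases hb : e = E1 ∧ a = A1
      · obtain ⟨rfl, rfl⟩ := hb
        simp only [decide_true, and_self, if_true, next, Policy.blockCost, Params.rate]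
        ring
      · have : (if e = E1 then (if a = A1 then M.blockCost y.1 else 0) else 0) = 0 := by
          split_ifs with h1 h2
          · exact absurd ⟨h1, h2⟩ hb
          · rfl
          · rfl
        rw [this]
        simp only [hb, decide_false, Bool.false_eq_true, if_false]
        ring
    simp_rw [hsplit, Finset.sum_sub_distrib, Finset.sum_add_distrib, ← Finset.sum_mul,
      M.sum_rate_mul_prob]
    have hd : ∑ e, ∑ a, p.rate y.1.1 e * M.prob y.1 e a * (h (next y.1.1 e a) - h y.1.1) =
      M.drift h y.1 := rfl
    have hblock : ∑ e : Event, ∑ a : Act,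
        (if e = E1 then (if a = A1 then M.blockCost y.1 else 0) else 0) = M.blockCost y.1 := by
      simp
    rw [hd, hblock, hh]
    have := (totalRate_pos hrate hlamV y.1.1).ne'
    split_ifs
    · rw [mul_inv_cancel₀ this]
      ring
    · ring

/-- `offload` on the state space. -/
noncomputable def offloadState (hW : kth ≤ p.W) (s : p.State) : p.State :=
  ⟨offload kth s.1, offload_mem hW s.2⟩

open Classical in
/-- The action in the offloaded state of `s` at event `e` which imitates action `a` at event `e'`
in `s`. -/
noncomputable def imitate (p : Params) (kth : ℕ) (s : Triple) (e e' : Event) (a : Act) : Act :=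
  if h : ∃ a', p.Feasible (offload kth s) e a' ∧
      next (offload kth s) e a' = offload kth (next s e' a) ∧ cost e a' = cost e' a
  then h.choose else A1

theorem imitate_spec (hW : kth ≤ p.W) {s : Triple} (hs : s ∈ p.states) {e e' : Event}
    {a : Act} (hm : Matches e e') (hpos : Possible (offload kth s) e) (hf : p.Feasible s e' a) :
    p.Feasible (offload kth s) e (imitate p kth s e e' a) ∧
      next (offload kth s) e (imitate p kth s e e' a) = offload kth (next s e' a) ∧
      cost e (imitate p kth s e e' a) = cost e' a := by
  have h := exists_imitating_act hW hs hm hpos hf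
  unfold imitate
  rw [dif_pos h]
  exact h.choose_spec

open Classical in
/-- Action probabilities in the offloaded state of `s` which imitate `M` in `s`. -/
noncomputable def Policy.imitProb (M : Policy p) (kth : ℕ) (s : p.State) (e : Event) (b : Act) :
    ℝ :=
  if Possible (offload kth s.1) e then
    ∑ e', mixWeight s.1 e e' *
      ∑ a, M.prob s e' a * (if b = imitate p kth s.1 e e' a then 1 else 0)
  else 0

theorem Policy.imitProb_nonneg (M : Policy p) (s : p.State) (e : Event) (b : Act) :
    0 ≤ M.imitProb kth s e b := by
  unfold Policy.imitProb
  split_ifs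
  · refine Finset.sum_nonneg fun e' _ => mul_nonneg (mixWeight_nonneg _ _ _)
      (Finset.sum_nonneg fun a _ => mul_nonneg (M.nonneg _ _ _) ?_)
    split_ifs <;> norm_num
  · exact le_rfl

theorem Policy.feasible_of_imitProb_ne_zero (hW : kth ≤ p.W) (M : Policy p) {s : p.State}
    {e : Event} {b : Act} (h : M.imitProb kth s e b ≠ 0) :
    p.Feasible (offload kth s.1) e b := by
  unfold Policy.imitProb at h
  split_ifs at h with he
  · obtain ⟨e', -, h1⟩ := Finset.exists_ne_zero_of_sum_ne_zero h
    obtain ⟨a, -, h2⟩ := Finset.exists_ne_zero_of_sum_ne_zero (right_ne_zero_of_mul h1)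
    have hb : b = imitate p kth s.1 e e' a := by
      by_contra hb
      rw [if_neg hb, mul_zero] at h2
      exact h2 rfl
    rw [hb]
    exact (imitate_spec hW s.2 (matches_of_mixWeight_ne_zero (left_ne_zero_of_mul h1)) he
      (M.feasible s e' a (left_ne_zero_of_mul h2))).1
  · exact absurd rfl h

theorem Policy.sum_imitProb_mul (M : Policy p) {s : p.State} {e : Event}
    (he : Possible (offload kth s.1) e) (ψ : Act → ℝ) :
    ∑ b, M.imitProb kth s e b * ψ b =
      ∑ e', mixWeight s.1 e e' * ∑ a, M.prob s e' a * ψ (imitate p kth s.1 e e' a) := by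
  simp only [Policy.imitProb, if_pos he, Finset.sum_mul]
  rw [Finset.sum_comm]
  refine Finset.sum_congr rfl fun e' _ => ?_
  simp only [mul_assoc, ← Finset.mul_sum, Finset.sum_mul]
  rw [Finset.sum_comm]
  congr 1
  refine Finset.sum_congr rfl fun a _ => ?_
  rw [← Finset.mul_sum]
  simp

theorem Policy.sum_imitProb (M : Policy p) {s : p.State} {e : Event}
    (he : Possible (offload kth s.1) e) : ∑ b, M.imitProb kth s e b = 1 := by
  have h := M.sum_imitProb_mul he fun _ => 1
  simp only [mul_one] at h
  rw [h, ← sum_mixWeight he]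
  refine Finset.sum_congr rfl fun e' _ => ?_
  by_cases hw : mixWeight s.1 e e' = 0
  · rw [hw, zero_mul]
  · rw [M.sum_one s e' (possible_of_mixWeight_ne_zero hw he), mul_one]

/-- Imitation preserves the blocking decisions. -/
theorem Policy.imitProb_block (hW : kth ≤ p.W) (M : Policy p) (s : p.State) :
    M.imitProb kth s E1 A1 = M.prob s E1 A1 := by
  have h := M.sum_imitProb_mul (kth := kth) (s := s) (e := E1) trivial fun b => cost E1 b
  have hc : ∀ (g : Act → ℝ), ∑ b, g b * cost E1 b = g A1 := fun g => by simp [cost]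
  rw [hc, sum_event] at h
  simp only [mixWeight, zero_mul, add_zero, one_mul] at h
  rw [h, ← hc (M.prob s E1)]
  refine Finset.sum_congr rfl fun a _ => ?_
  by_cases ha : M.prob s E1 a = 0
  · rw [ha, zero_mul, zero_mul]
  · rw [(imitate_spec (e := E1) hW s.2 (Or.inl rfl) trivial (M.feasible s E1 a ha)).2.2]

/-- Under imitation the offloaded state moves as the image of the original state. -/
theorem Policy.sum_rate_imitProb (hW : kth ≤ p.W) (M : Policy p) (φ : Triple → ℝ) (s : p.State) :
    ∑ e, ∑ b, p.rate (offload kth s.1) e * M.imitProb kth s e b *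
        (φ (next (offload kth s.1) e b) - φ (offload kth s.1)) =
      M.drift (fun t => φ (offload kth t)) s := by
  simp only [Policy.drift, mul_assoc, ← Finset.mul_sum]
  rw [sum_rate_regroup (kth := kth) s.1 fun e =>
    ∑ a, M.prob s e a * (φ (offload kth (next s.1 e a)) - φ (offload kth s.1))]
  refine Finset.sum_congr rfl fun e _ => ?_
  by_cases he : Possible (offload kth s.1) e
  · congr 1
    rw [M.sum_imitProb_mul he fun b =>
      φ (next (offload kth s.1) e b) - φ (offload kth s.1)]
    refine Finset.sum_congr rfl fun e' _ => ?_
    by_cases hw : mixWeight s.1 e e' = 0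
    · rw [hw, zero_mul, zero_mul]
    congr 1
    refine Finset.sum_congr rfl fun a _ => ?_
    by_cases ha : M.prob s e' a = 0
    · rw [ha, zero_mul, zero_mul]
    · rw [(imitate_spec hW s.2 (matches_of_mixWeight_ne_zero hw) he
        (M.feasible s e' a ha)).2.1]
  · rw [rate_eq_zero_of_not_possible he, zero_mul, zero_mul]

section Pushforward

variable {X : Type*} [Fintype X] [DecidableEq X]

/-- The image of the weights `π` under `S`. -/
def pushWeight (S : X → X) (π : X → ℝ) (t : X) : ℝ := ∑ s, if S s = t then π s else 0

theorem pushWeight_nonneg {S : X → X} {π : X → ℝ} (hπ : ∀ s, 0 ≤ π s) (t : X) :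
    0 ≤ pushWeight S π t :=
  Finset.sum_nonneg fun s _ => by split_ifs; exacts [hπ s, le_rfl]

theorem sum_pushWeight_mul (S : X → X) (π g : X → ℝ) :
    ∑ t, pushWeight S π t * g t = ∑ s, π s * g (S s) := by
  simp only [pushWeight, Finset.sum_mul]
  rw [Finset.sum_comm]
  refine Finset.sum_congr rfl fun s _ => ?_
  simp [ite_mul]

theorem pushWeight_mul_eq_zero {S : X → X} {π : X → ℝ} (hπ : ∀ s, 0 ≤ π s) {t : X}
    (ht : pushWeight S π t = 0) (g : X → ℝ) : pushWeight S (fun s => π s * g s) t = 0 := by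
  have h := (Finset.sum_eq_zero_iff_of_nonneg fun s _ => by
    split_ifs; exacts [hπ s, le_rfl]).1 ht
  refine Finset.sum_eq_zero fun s hs => ?_
  have h1 := h s hs
  split_ifs at h1 ⊢
  · change π s * g s = 0
    rw [h1, zero_mul]
  · rfl

end Pushforward

open Classical in
/-- The policy whose stationary distribution is the image of that of `M` under offloading. -/
noncomputable def Policy.improved (hW : kth ≤ p.W) (M : Policy p) {π : p.State → ℝ}
    (hπ : ∀ s, 0 ≤ π s) : Policy p where
  prob t e a :=
    if pushWeight (offloadState hW) π t = 0 then M.prob t e a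
    else pushWeight (offloadState hW) (fun s => π s * M.imitProb kth s e a) t /
      pushWeight (offloadState hW) π t
  nonneg t e a := by
    split_ifs
    · exact M.nonneg _ _ _
    · exact div_nonneg (pushWeight_nonneg (fun s => mul_nonneg (hπ s) (M.imitProb_nonneg _ _ _)) _)
        (pushWeight_nonneg hπ _)
  feasible t e a h := by
    split_ifs at h with h0
    · exact M.feasible t e a h
    · obtain ⟨s, -, hs⟩ := Finset.exists_ne_zero_of_sum_ne_zero (div_ne_zero_iff.1 h).1
      split_ifs at hs with hst
      · rw [← hst]
        exact M.feasible_of_imitProb_ne_zero hW (right_ne_zero_of_mul hs)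
      · exact absurd rfl hs
  sum_one t e he := by
    split_ifs with h0
    · exact M.sum_one t e he
    · rw [← Finset.sum_div, div_eq_one_iff_eq h0]
      simp only [pushWeight]
      rw [Finset.sum_comm]
      refine Finset.sum_congr rfl fun s _ => ?_
      split_ifs with hst
      · rw [← hst] at he
        rw [← Finset.mul_sum, M.sum_imitProb he, mul_one]
      · simp

theorem Policy.sum_improved (hW : kth ≤ p.W) (M : Policy p) {π : p.State → ℝ}
    (hπ : ∀ s, 0 ≤ π s) (e : Event) (a : Act) (g : p.State → ℝ) :
    ∑ t, pushWeight (offloadState hW) π t * ((M.improved hW hπ).prob t e a * g t) =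
      ∑ s, π s * (M.imitProb kth s e a * g (offloadState hW s)) := by
  have h : ∀ t, pushWeight (offloadState hW) π t * (M.improved hW hπ).prob t e a =
      pushWeight (offloadState hW) (fun s => π s * M.imitProb kth s e a) t := fun t => by
    simp only [Policy.improved]
    split_ifs with h0
    · rw [pushWeight_mul_eq_zero hπ h0, h0, zero_mul]
    · rw [mul_div_cancel₀ _ h0]
  simp only [← mul_assoc, h]
  exact sum_pushWeight_mul _ _ _

theorem Policy.improved_isStationary (hW : kth ≤ p.W) {M : Policy p} {π : p.State → ℝ}
    (hπ : M.IsStationary π) :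
    (M.improved hW hπ.nonneg).IsStationary (pushWeight (offloadState hW) π) := by
  refine ⟨pushWeight_nonneg hπ.nonneg, ?_, fun φ => ?_⟩
  · have h := sum_pushWeight_mul (offloadState hW) π fun _ => 1
    simp only [mul_one] at h
    rw [h, hπ.sum_one]
  · refine Eq.trans ?_ (hπ.balance fun t => φ (offload kth t))
    simp only [← M.sum_rate_imitProb hW]
    have hl : ∀ t, pushWeight (offloadState hW) π t * (M.improved hW hπ.nonneg).drift φ t =
        ∑ e, ∑ a, pushWeight (offloadState hW) π t * ((M.improved hW hπ.nonneg).prob t e a *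
          (p.rate t.1 e * (φ (next t.1 e a) - φ t.1))) := fun t => by
      simp only [Policy.drift, Finset.mul_sum]
      exact Finset.sum_congr rfl fun e _ => Finset.sum_congr rfl fun a _ => by ring
    simp only [hl, Finset.mul_sum]
    rw [Finset.sum_comm, Finset.sum_comm (s := (Finset.univ : Finset p.State))]
    refine Finset.sum_congr rfl fun e _ => ?_
    rw [Finset.sum_comm, Finset.sum_comm (s := (Finset.univ : Finset p.State))]
    refine Finset.sum_congr rfl fun a _ => ?_
    rw [M.sum_improved hW hπ.nonneg e a]
    exact Finset.sum_congr rfl fun s _ => by simp only [offloadState]; ring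

theorem Policy.improved_blockCost (hW : kth ≤ p.W) {M : Policy p} {π : p.State → ℝ}
    (hπ : ∀ s, 0 ≤ π s) :
    ∑ t, pushWeight (offloadState hW) π t * (M.improved hW hπ).blockCost t =
      ∑ s, π s * M.blockCost s := by
  have h := M.sum_improved hW hπ E1 A1 fun t => p.lamV / p.totalRate t.1
  simp only [M.imitProb_block hW, offloadState, totalRate_offload] at h
  simp only [Policy.blockCost]
  convert h using 3 <;> ring

/-- A policy with a recurrent state holding a misplaced data user is strictly improved, at the same
blocking cost, by another policy. -/
theorem Policy.exists_better (hrate : ∀ s e, 0 ≤ p.rate s e) (hlamV : 0 < p.lamV)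
    (hmuV : 0 < p.muV) (hmuD : 0 < p.muD) (hk : p.IsThreshold kth) (hW : kth ≤ p.W)
    (M : Policy p) {s : p.State} (hs : M.Recurrent s) (hmis : Misplaced kth s.1) :
    ∃ (M' : Policy p) (v v' b : ℝ), v < v' ∧ M.HasAvgReward v ∧ M.HasAvgCost b ∧
      M'.HasAvgReward v' ∧ M'.HasAvgCost b := by
  obtain ⟨π, hπ, hpos, -⟩ := M.exists_isStationary hrate hmuV hmuD
  have h := hπ.hasAvg hrate hlamV hmuV hmuD
  have h' := (Policy.improved_isStationary hW hπ).hasAvg hrate hlamV hmuV hmuD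
  rw [Policy.improved_blockCost, sum_pushWeight_mul _ _ fun t : p.State => p.f t.1] at h'
  refine ⟨_, _, _, _, ?_, h.1, h.2, h'.1, h'.2⟩
  refine Finset.sum_lt_sum (fun t _ => mul_le_mul_of_nonneg_left (f_le_f_offload hk _) (hπ.nonneg t))
    ⟨s, Finset.mem_univ s, mul_lt_mul_of_pos_left (f_lt_f_offload hk hmis) (hpos s hs)⟩

theorem Policy.HasAvgReward.unique {M : Policy p} {v v' : ℝ} (h : M.HasAvgReward v)
    (h' : M.HasAvgReward v') : v = v' :=
  tendsto_nhds_unique (h p.emptyState) (h' p.emptyState)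

theorem Policy.HasAvgCost.unique {M : Policy p} {b b' : ℝ} (h : M.HasAvgCost b)
    (h' : M.HasAvgCost b') : b = b' :=
  tendsto_nhds_unique (h p.emptyState) (h' p.emptyState)

theorem Policy.Recurrent.step {M : Policy p} {s s' : p.State} (hs : M.Recurrent s)
    (h : M.Step s s') : M.Recurrent s' := fun t ht =>
  (hs t (Relation.ReflTransGen.head h ht)).tail h

theorem Policy.prob_eq_one_of_unique (M : Policy p) {s : p.State} {e : Event} {a : Act}
    (he : Possible s.1 e) (h : ∀ b, b ≠ a → M.prob s e b = 0) : M.prob s e a = 1 := by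
  rw [← M.sum_one s e he]
  exact (Finset.sum_eq_single a (fun b _ hb => h b hb) (by simp)).symm

/-- A policy without misplaced data users in its recurrent states serves data users on WiFi. -/
theorem Policy.servesOnWiFi_of_not_misplaced (hlamD : 0 < p.lamD) (hmuV : 0 < p.muV)
    {M : Policy p} (h : ∀ s, M.Recurrent s → ¬ Misplaced kth s.1) : M.ServesOnWiFi kth := by
  intro s hs hC hjk
  have hj : s.1.j = 0 := by
    by_contra hj
    exact h s hs ⟨by omega, by omega⟩
  have key : ∀ e b, 0 < p.rate s.1 e → Misplaced kth (next s.1 e b) → M.prob s e b = 0 := by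
    intro e b hr hmis
    by_contra hb
    exact h ⟨_, next_mem p s.1 s.2 e b (M.feasible s e b hb)⟩
      (hs.step ⟨e, b, hr, lt_of_le_of_ne (M.nonneg s e b) (Ne.symm hb), rfl⟩) hmis
  have infeas : ∀ e b, ¬ p.Feasible s.1 e b → M.prob s e b = 0 := fun e b hb => by
    by_contra h0
    exact hb (M.feasible s e b h0)
  refine ⟨hj, fun hlt => ?_, fun hi => ?_, fun hk => ?_⟩
  · refine M.prob_eq_one_of_unique trivial fun b hb => ?_
    cases b
    case A2 => exact key E2 A2 hlamD ⟨by simp [next], by simp only [next]; omega⟩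
    case A3 => exact absurd rfl hb
    all_goals exact infeas _ _ (by simp [Params.Feasible] <;> omega)
  · refine M.prob_eq_one_of_unique hi fun b hb => ?_
    cases b
    case A1 => exact absurd rfl hb
    case A5 =>
      by_cases hk : s.1.k = 0
      · exact infeas _ _ fun hf => hf.2 hk
      · exact key E3 A5 (mul_pos (Nat.cast_pos.2 hi) hmuV)
          ⟨by simp [next], by simp only [next]; omega⟩
    all_goals exact infeas _ _ (by simp [Params.Feasible])
  · refine M.prob_eq_one_of_unique hk fun b hb => ?_
    cases b
    case A1 => exact absurd rfl hb
    all_goals exact infeas _ _ (by simp [Params.Feasible] <;> omega)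

end HetNet

theorem lemma1 (p : HetNet.Params) (kth : ℕ)
    (hlamV : 0 < p.lamV) (hlamD : 0 < p.lamD) (hmuV : 0 < p.muV) (hmuD : 0 < p.muD)
    (hkth : p.IsThreshold kth) (hkthW : kth ≤ p.W) :
    (∀ M : HetNet.Policy p, M.IsOptimal → M.ServesOnWiFi kth) ∧
    (∀ (Bmax : ℝ) (M : HetNet.Policy p), M.IsConstrainedOptimal Bmax → M.ServesOnWiFi kth) ∧
    (∀ δ : ℝ, 0 < δ → (∀ s ∈ p.states, p.totalRate s * δ ≤ 1) → ∀ β : ℝ,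
      (∀ n : ℕ, p.ServesOnWiFi kth β (p.valueIter δ β n)) ∧
      (∀ (g : ℝ) (V : HetNet.Triple → ℝ), p.IsDPSolution δ β g V → p.ServesOnWiFi kth β V)) := by
  have hrate := HetNet.rate_nonneg hlamV hlamD hmuV hmuD
  refine ⟨fun M hM => ?_, fun Bmax M hM => ?_, fun δ hδ hunif β => ⟨fun n => ?_, fun g V hV => ?_⟩⟩
  · refine HetNet.Policy.servesOnWiFi_of_not_misplaced hlamD hmuV fun s hs hmis => ?_
    obtain ⟨M', v, v', b, hlt, hv, -, hv', -⟩ :=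
      M.exists_better hrate hlamV hmuV hmuD hkth hkthW hs hmis
    obtain ⟨w, hw, hopt⟩ := hM
    rw [hw.unique hv] at hopt
    exact absurd (hopt M' v' hv') (not_le.2 hlt)
  · refine HetNet.Policy.servesOnWiFi_of_not_misplaced hlamD hmuV fun s hs hmis => ?_
    obtain ⟨M', v, v', b, hlt, hv, hb, hv', hb'⟩ :=
      M.exists_better hrate hlamV hmuV hmuD hkth hkthW hs hmis
    obtain ⟨w, c, hw, hc, hcB, hopt⟩ := hM
    rw [hw.unique hv] at hopt
    rw [hc.unique hb] at hcB
    exact absurd (hopt M' v' b hv' hb' hcB) (not_le.2 hlt)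
  · exact HetNet.servesOnWiFi_of_le_offload hkth hkthW
      (HetNet.valueIter_le_offload hkth hkthW hrate hδ hunif β n)
  · exact HetNet.servesOnWiFi_of_le_offload hkth hkthW
      (HetNet.dpSolution_le_offload hkth hkthW hrate hlamV hδ hV)
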